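/- **Setting.** Bundles are vectors in $\mathbb{R}_+^n$, ordered componentwise; $y<x$ means $y\le x$ and $y\ne x$. A data set $\mathcal D$ consists of finitely many decisions $t$, each with finitely many subdecisions $k$; in subdecision $(t,k)$ the bundle $x^{t,k}\in B^{t,k}$ is chosen from the feasible set $B^{t,k}\subseteq\mathbb{R}_+^n$ (an arbitrary set). Put $x^t=\sum_k x^{t,k}$, $x^{t,-k}=\sum_{j\neq k}x^{t,j}$, $B^t=\{\sum_k z^k: z^k\in B^{t,k}\}$, $\mathcal D^{BB}=\{(x^t,B^t)\}_t$ and $\mathcal D^{NB}=\{(x^{t,k},B^{t,k})\}_{(t,k)}$. Below, $\arg\max$ is the unique maximizer, and "increasing" may be read throughout either as weakly increasing ($x\le y\Rightarrow u(x)\le u(y)$) or as strictly increasing ($x<y\Rightarrow u(x)<u(y)$). $\mathcal D$ is rationalizable by - *broad bracketing* if for some increasing $u:\mathbb{R}_+^n\to\mathbb{R}$, $x^t=\arg\max_{x\in B^t}u(x)$ for all $t$; - *narrow bracketing* if for some increasing $u$, $x^{t,k}=\arg\max_{x\in B^{t,k}}u(x)$ for all $(t,k)$; - *$\alpha$-partial-narrow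 bracketing* if for some increasing $u$, $x^{t,k}=\arg\max_{x\in B^{t,k}}[\alpha u(x)+(1-\alpha)u(x^{t,-k}+x)]$ for all $(t,k)$. For a set $\mathcal E$ of observations $(x,B)$, write $xP^{\mathcal E}y$ if $(x,B)\in\mathcal E$ and $y\in B\setminus\{x\}$ for some $B$. $\mathcal E$ satisfies *SARP* if $P^{\mathcal E}$ is acyclic, and *monotone SARP* if the union of $P^{\mathcal E}$ and the dominance relation $x>y$ is acyclic. $\mathcal E$ is *undominated* if $y\in B$ and $y\geq x$ imply $y=x$, for all $(x,B)\in\mathcal E$; it has *free disposal* if $0\le y\le z\in B$ implies $y\in B$, for all $(x,B)\in\mathcal E$. **Theorem.** (i) $\mathcal D$ is rationalizable by broad bracketing if and only if $\mathcal D^{BB}$ satisfies monotone SARP. If $\mathcal D^{BB}$ is undominated and has free disposal, then $\mathcal D^{BB}$ satisfies SARP if and only if $\mathcal D$ is rationalizable by broad bracketing. (ii) $\mathcal D$ is rationalizable by narrow bracketing if and only if $\mathcal D^{NB}$ satisfies monotone SARP. If $\mathcal D^{NB}$ is undominated and has free disposal, then $\mathcal D^{NB}$ satisfies SARP if and only if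 $\mathcal D$ is rationalizable by narrow bracketing. (iii) For real $\alpha\in[0,1]$ let $(\alpha,y;1-\alpha,y')$ be the lottery that gives $y$ with probability $\alpha$ and $y'$ with probability $1-\alpha$, let $p^{t,k}=(\alpha,x^{t,k};1-\alpha,x^t)$, let $Y\subset\mathbb{R}_+^n$ be any finite set containing $0$ and the supports of all $p^{t,k}$, let $\Delta Y$ be the set of lotteries over $Y$, and let $\mathcal D^\alpha=\{(p^{t,k},Q^{t,k})\}_{(t,k)}$, where $$Q^{t,k}=\{(\alpha,y;1-\alpha,y'): y,y'\in Y,\ y\le x \text{ and } y'\le x+x^{t,-k}\text{ for some }x\in B^{t,k}\}.$$ Write $p\succ q$ if $p=p^{t,k}$ and $q\in Q^{t,k}\setminus\{p\}$ for some $(t,k)$. Write $p\,\tilde\succsim\,q$ if there are $r,p_1,\dots,p_N,q_1,\dots,q_N\in\Delta Y$, $\theta\in(0,1]$ and $\lambda_1,\dots,\lambda_N>0$ with $\sum_i\lambda_i=1$, $\theta p+(1-\theta)r=\sum_i\lambda_ip_i$, $\theta q+(1-\theta)r=\sum_i\lambda_iq_i$ and, for every $i$, $p_i\succ q_i$ or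 $p_i=q_i$; write $p\,\tilde\succ\,q$ if moreover $p_i\succ q_i$ for some $i$. The linear axiom of revealed preference (LARP) says that for $p,q\in\Delta Y$, $q\,\tilde\succsim\,p$ excludes $p\,\tilde\succ\,q$. Then $\mathcal D$ is rationalizable by $\alpha$-partial-narrow bracketing if and only if $\mathcal D^{NB}$ is undominated and $\mathcal D^\alpha$ satisfies LARP. Moreover there is an algorithm (a total computable function, one for all $n$, all $\mathcal D$ and all rational $\alpha\in[0,1]$) which, given $\alpha$ as a fraction and any finite description of $\mathcal D^\alpha$ (in which the elements of $Y$ are numbered and the lotteries $(\alpha,y;1-\alpha,y')$ are listed as pairs of numbers), outputs $1$ exactly when $\mathcal D$ is rationalizable by $\alpha$-partial-narrow bracketing, provided that $\mathcal D^{NB}$ is undominated. -/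

import Mathlib

open scoped NNReal BigOperators

noncomputable section

namespace Bracketing

/-- Bundles of `n` goods: the nonnegative orthant, with the componentwise order. -/
abbrev Bundle (n : ℕ) := Fin n → ℝ≥0

/-- A finite data set of choices: `T` decisions, decision `t` has `K t` subdecisions, and in
subdecision `(t, k)` the bundle `x t k` is chosen from the feasible set `B t k`. -/
structure DataSet (n : ℕ) where
  T : ℕ
  K : Fin T → ℕ
  x : (t : Fin T) → Fin (K t) → Bundle n
  B : (t : Fin T) → Fin (K t) → Set (Bundle n)
  x_mem : ∀ t k, x t k ∈ B t k

/-- The two usual senses of an increasing function. -/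
inductive Sense
  | weak
  | strict

/-- `u` is increasing: weakly (`x ≤ y` gives `u x ≤ u y`), or strictly (`x ≤ y` and `x ≠ y` give
`u x < u y`). -/
def Increasing {n : ℕ} : Sense → (Bundle n → ℝ) → Prop
  | Sense.weak, u => Monotone u
  | Sense.strict, u => StrictMono u

/-- `x = argmax_{y ∈ B} v y`: the bundle `x` is the one and only maximizer of `v` over `B`. -/
def IsArgmax {n : ℕ} (v : Bundle n → ℝ) (B : Set (Bundle n)) (x : Bundle n) : Prop :=
  x ∈ B ∧ ∀ y ∈ B, y ≠ x → v y < v x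

namespace DataSet

variable {n : ℕ} (D : DataSet n)

/-- The final bundle `x^t` of decision `t`. -/
def xTot (t : Fin D.T) : Bundle n := ∑ k, D.x t k

/-- The sum `x^{t,-k}` of the choices in the other subdecisions of decision `t`. -/
def xOther (t : Fin D.T) (k : Fin (D.K t)) : Bundle n := ∑ j ∈ Finset.univ.erase k, D.x t j

/-- The set `B^t` of feasible final bundles of decision `t`. -/
def BTot (t : Fin D.T) : Set (Bundle n) :=
  {z | ∃ w : Fin (D.K t) → Bundle n, (∀ k, w k ∈ D.B t k) ∧ z = ∑ k, w k}

/-- The aggregated observations `(x^t, B^t)`. -/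
def BB : Set (Bundle n × Set (Bundle n)) :=
  {o | ∃ t, o = (D.xTot t, D.BTot t)}

/-- Each subdecision as an observation of its own. -/
def NB : Set (Bundle n × Set (Bundle n)) :=
  {o | ∃ t k, o = (D.x t k, D.B t k)}

/-- Rationalizability by broad bracketing. -/
def RationalizableBB (s : Sense) : Prop :=
  ∃ u : Bundle n → ℝ, Increasing s u ∧ ∀ t, IsArgmax u (D.BTot t) (D.xTot t)

/-- Rationalizability by narrow bracketing. -/
def RationalizableNB (s : Sense) : Prop :=
  ∃ u : Bundle n → ℝ, Increasing s u ∧ ∀ t k, IsArgmax u (D.B t k) (D.x t k)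

/-- Rationalizability by `α`-partial-narrow bracketing. -/
def RationalizablePNB (s : Sense) (α : ℝ) : Prop :=
  ∃ u : Bundle n → ℝ, Increasing s u ∧
    ∀ t k, IsArgmax (fun y => α * u y + (1 - α) * u (D.xOther t k + y)) (D.B t k) (D.x t k)

end DataSet

/-! ### Revealed preference -/

/-- `x P y`: for some observed budget set `B`, `x` is chosen from `B` and `y ∈ B \ {x}`. -/
def DirectlyRevealed {n : ℕ} (E : Set (Bundle n × Set (Bundle n))) (x y : Bundle n) : Prop :=
  ∃ B, (x, B) ∈ E ∧ y ∈ B \ {x}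

/-- A relation is acyclic if there is no cycle `x R x₁ R x₂ R ⋯ R x`. -/
def Acyclic {X : Type} (R : X → X → Prop) : Prop := ∀ x, ¬ Relation.TransGen R x x

/-- The strong axiom of revealed preference. -/
def SARP {n : ℕ} (E : Set (Bundle n × Set (Bundle n))) : Prop :=
  Acyclic (DirectlyRevealed E)

/-- The strong axiom where a bundle also counts as preferred to every other bundle
that it dominates. -/
def MonotoneSARP {n : ℕ} (E : Set (Bundle n × Set (Bundle n))) : Prop :=
  Acyclic (fun x y => DirectlyRevealed E x y ∨ y < x)

/-- No feasible bundle dominates the chosen one. -/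
def Undominated {n : ℕ} (E : Set (Bundle n × Set (Bundle n))) : Prop :=
  ∀ x B, (x, B) ∈ E → ∀ y ∈ B, x ≤ y → y = x

/-- Free disposal: with a bundle, a budget set contains all smaller bundles. -/
def FreeDisposal {n : ℕ} (E : Set (Bundle n × Set (Bundle n))) : Prop :=
  ∀ x B, (x, B) ∈ E → IsLowerSet B

/-! ### Lotteries over a finite set of bundles -/

/-- The set `ΔY` of lotteries over the finite set `Y`. -/
def lotteries {n : ℕ} (Y : Finset (Bundle n)) : Set (Bundle n →₀ ℝ) :=
  {p | (∀ y, 0 ≤ p y) ∧ p.support ⊆ Y ∧ (p.sum fun _ w => w) = 1}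

/-- The lottery `(α, y; 1 - α, y')`. -/
def lottery {n : ℕ} (α : ℝ) (y y' : Bundle n) : Bundle n →₀ ℝ :=
  Finsupp.single y α + Finsupp.single y' (1 - α)

namespace DataSet

variable {n : ℕ} (D : DataSet n)

/-- The lottery `p^{t,k} = (α, x^{t,k}; 1 - α, x^t)`. -/
def lotteryChoice (α : ℝ) (t : Fin D.T) (k : Fin (D.K t)) : Bundle n →₀ ℝ :=
  lottery α (D.x t k) (D.xTot t)

/-- The budget set `Q^{t,k}` of lotteries over `Y` that are affordable in subdecision `(t, k)`. -/
def lotteryBudget (α : ℝ) (Y : Finset (Bundle n)) (t : Fin D.T) (k : Fin (D.K t)) :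
    Set (Bundle n →₀ ℝ) :=
  {q | ∃ y ∈ Y, ∃ y' ∈ Y, q = lottery α y y' ∧
    ∃ x ∈ D.B t k, y ≤ x ∧ y' ≤ x + D.xOther t k}

/-- The lottery data set `D^α`. -/
def lotteryData (α : ℝ) (Y : Finset (Bundle n)) :
    Set ((Bundle n →₀ ℝ) × Set (Bundle n →₀ ℝ)) :=
  {o | ∃ t k, o = (D.lotteryChoice α t k, D.lotteryBudget α Y t k)}

/-- `Y` contains the zero bundle and the supports of all the lotteries `p^{t,k}`. -/
def Supports (α : ℝ) (Y : Finset (Bundle n)) : Prop :=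
  0 ∈ Y ∧ ∀ t k, (D.lotteryChoice α t k).support ⊆ Y

end DataSet

/-- `p ≻ q`: the lottery `p` is chosen from a budget set that contains `q ≠ p`. -/
def LotteryRevealed {n : ℕ} (E : Set ((Bundle n →₀ ℝ) × Set (Bundle n →₀ ℝ)))
    (p q : Bundle n →₀ ℝ) : Prop :=
  ∃ Q, (p, Q) ∈ E ∧ q ∈ Q \ {p}

/-- `p` and `q` have, after mixing both with one and the same lottery `r`, decompositions into
`ps i` and `qs i` with the same positive weights, where `ps i ≻ qs i` or `ps i = qs i`. -/
def MixtureDecomposition {n : ℕ} (Y : Finset (Bundle n))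
    (E : Set ((Bundle n →₀ ℝ) × Set (Bundle n →₀ ℝ))) (p q : Bundle n →₀ ℝ)
    {N : ℕ} (ps qs : Fin N → Bundle n →₀ ℝ) : Prop :=
  ∃ r ∈ lotteries Y, ∃ θ : ℝ, 0 < θ ∧ θ ≤ 1 ∧ ∃ c : Fin N → ℝ,
    (∀ i, ps i ∈ lotteries Y) ∧ (∀ i, qs i ∈ lotteries Y) ∧
    (∀ i, 0 < c i) ∧ ∑ i, c i = 1 ∧
    θ • p + (1 - θ) • r = ∑ i, c i • ps i ∧
    θ • q + (1 - θ) • r = ∑ i, c i • qs i ∧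
    ∀ i, LotteryRevealed E (ps i) (qs i) ∨ ps i = qs i

/-- `p` is indirectly revealed preferred to `q` via independence. -/
def IndirectlyWeak {n : ℕ} (Y : Finset (Bundle n))
    (E : Set ((Bundle n →₀ ℝ) × Set (Bundle n →₀ ℝ))) (p q : Bundle n →₀ ℝ) : Prop :=
  ∃ (N : ℕ) (ps qs : Fin N → Bundle n →₀ ℝ), MixtureDecomposition Y E p q ps qs

/-- `p` is indirectly revealed strictly preferred to `q` via independence. -/
def IndirectlyStrict {n : ℕ} (Y : Finset (Bundle n))
    (E : Set ((Bundle n →₀ ℝ) × Set (Bundle n →₀ ℝ))) (p q : Bundle n →₀ ℝ) : Prop :=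
  ∃ (N : ℕ) (ps qs : Fin N → Bundle n →₀ ℝ), MixtureDecomposition Y E p q ps qs ∧
    ∃ i, LotteryRevealed E (ps i) (qs i)

/-- The linear axiom of revealed preference. -/
def LARP {n : ℕ} (Y : Finset (Bundle n))
    (E : Set ((Bundle n →₀ ℝ) × Set (Bundle n →₀ ℝ))) : Prop :=
  ∀ p ∈ lotteries Y, ∀ q ∈ lotteries Y, IndirectlyWeak Y E q p → ¬ IndirectlyStrict Y E p q

/-! ### Inputs of the algorithm -/

/-- A finite description of a lottery data set: `((a, b), m, L)` stands for the weight `α = a / b`,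
outcomes numbered `0, …, m - 1`, and a list `L` of observations. A pair `(i, j)` stands for
the lottery that gives outcome `i` with probability `α` and outcome `j` with probability `1 - α`;
an observation is a chosen lottery with the list of lotteries it was chosen from. -/
abbrev Code := (ℕ × ℕ) × ℕ × List ((ℕ × ℕ) × List (ℕ × ℕ))

/-- `c` describes the lottery data set `E` over `Y` with weight `α`, for some
numbering `y` of `Y`. -/
def Describes {n : ℕ} (c : Code) (α : ℝ) (Y : Finset (Bundle n))
    (E : Set ((Bundle n →₀ ℝ) × Set (Bundle n →₀ ℝ))) : Prop :=
  c.1.2 ≠ 0 ∧ α = (c.1.1 : ℝ) / (c.1.2 : ℝ) ∧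
  ∃ y : ℕ → Bundle n, Set.BijOn y (Set.Iio c.2.1) (Y : Set (Bundle n)) ∧
    (∀ o ∈ c.2.2, (o.1.1 < c.2.1 ∧ o.1.2 < c.2.1) ∧
      ∀ e ∈ o.2, e.1 < c.2.1 ∧ e.2 < c.2.1) ∧
    E = {o' | ∃ o ∈ c.2.2, o' = (lottery α (y o.1.1) (y o.1.2),
      {q | ∃ e ∈ o.2, q = lottery α (y e.1) (y e.2)})}

end Bracketing

end

/-! For (i) and (ii), let `R` be the union of revealed preference and dominance. The utility of a
bundle is the number of observations whose choice is `R`-reachable from it, plus a strictly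
increasing function with values in [0, 1). Acyclicity makes the count drop by at least one along
each revealed comparison, which outweighs the bounded term. Along dominance the count cannot move
the wrong way and the bounded term is strict (`monotoneSARP_iff`). With free disposal and no
dominated choices, a dominance step is absorbed by the revealed step before it
(`sarp_iff_monotoneSARP`).

For (iii), Gordan's theorem (`exists_pos_functional_or_posComb_zero`) turns LARP into the existence
of a linear functional that puts chosen lotteries above rejected ones. Expected utility is such a
functional once ties are broken by a strictly increasing utility. Conversely, a functional assigns
values to the elements of `Y`; the best value in `Y` below a bundle extends them monotonically, and
a large multiple of this plus a bounded strictly increasing term rationalizes the data.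

For the algorithm, a rational weight gives integer comparisons. Gordan's theorem over ℚ provides a
finite certificate either way: natural-number values that agree with all comparisons, or a list of
comparisons whose two sides cancel. Both kinds can be enumerated, so the question is decidable
(`computablePred_feasible`). -/

namespace Bracketing

/-! ### A theorem of the alternative over ordered fields -/

section Alternative

/-- A large multiple of `F` dominates `G` wherever `F` is positive. -/
theorem exists_pos_mul_add_pos {K : Type*} [Field K] [LinearOrder K] [IsStrictOrderedRing K]
    {X : Type*} {S : Set X} (hS : S.Finite) (F G : X → K)
    (h : ∀ x ∈ S, 0 < F x ∨ (F x = 0 ∧ 0 < G x)) : ∃ M : K, 0 < M ∧ ∀ x ∈ S, 0 < M * F x + G x := by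
  have key : ∃ M₀ : K, ∀ x ∈ S, - G x / F x ≤ M₀ := by
    obtain ⟨M, hM⟩ := (hS.image fun x => - G x / F x).bddAbove
    exact ⟨M, fun x hx => hM ⟨x, hx, rfl⟩⟩
  obtain ⟨M₀, hM₀⟩ := key
  refine ⟨max M₀ 0 + 1, by positivity, fun x hx => ?_⟩
  rcases h x hx with hF | ⟨hF, hG⟩
  · have h1 : - G x / F x < max M₀ 0 + 1 :=
      lt_of_le_of_lt ((hM₀ x hx).trans (le_max_left _ _)) (lt_add_one _)
    rw [div_lt_iff₀ hF] at h1
    linarith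
  · rw [hF]; simpa using hG
variable {K : Type*} [Field K] [LinearOrder K]

variable {V : Type*} [AddCommGroup V] [Module K V]

variable (K) in
/-- The nonempty positive combinations of elements of `S`. -/
inductive PosComb (S : Set V) : V → Prop
  | of {x} : x ∈ S → PosComb S x
  | add {x y} : PosComb S x → PosComb S y → PosComb S (x + y)
  | smul {c : K} {x} : 0 < c → PosComb S x → PosComb S (c • x)

theorem PosComb.mono {S T : Set V} (h : S ⊆ T) {x : V} (hx : PosComb K S x) : PosComb K T x := by
  induction hx with
  | of hx => exact .of (h hx)
  | add _ _ h1 h2 => exact .add h1 h2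
  | smul hc _ h1 => exact .smul hc h1

theorem PosComb.exists_of_image {W : Type*} [AddCommGroup W] [Module K W] (π : V →ₗ[K] W)
    {S : Set V} {y : W} (hy : PosComb K (π '' S) y) : ∃ x, PosComb K S x ∧ π x = y := by
  induction hy with
  | of hx => obtain ⟨x, hx, rfl⟩ := hx; exact ⟨x, .of hx, rfl⟩
  | add _ _ h1 h2 =>
    obtain ⟨x, hx, rfl⟩ := h1
    obtain ⟨y, hy, rfl⟩ := h2
    exact ⟨x + y, .add hx hy, map_add _ _ _⟩
  | smul hc _ h1 =>
    obtain ⟨x, hx, rfl⟩ := h1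
    exact ⟨_, .smul hc hx, map_smul _ _ _⟩

variable [IsStrictOrderedRing K]

theorem PosComb.map_pos {S : Set V} {f : V →ₗ[K] K} (hf : ∀ s ∈ S, 0 < f s) {x : V}
    (hx : PosComb K S x) : 0 < f x := by
  induction hx with
  | of hx => exact hf _ hx
  | add _ _ h1 h2 => rw [map_add]; exact add_pos h1 h2
  | smul hc _ h1 => rw [map_smul]; exact mul_pos hc h1

/-- **Gordan's theorem**: either some linear functional is positive on the finite set `S`, or `0` is
a nonempty positive combination of elements of `S`. -/
theorem exists_pos_functional_or_posComb_zero {S : Set V} (hS : S.Finite) :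
    (∃ f : V →ₗ[K] K, ∀ s ∈ S, 0 < f s) ∨ PosComb K S (0 : V) := by
  obtain ⟨n, hn⟩ : ∃ n, S.ncard = n := ⟨_, rfl⟩
  induction n using Nat.strong_induction_on generalizing S with
  | _ n ih =>
  rcases S.eq_empty_or_nonempty with rfl | ⟨a, ha⟩
  · exact .inl ⟨0, by simp⟩
  have hlt : (S \ {a}).ncard < n := hn ▸ Set.ncard_sdiff_singleton_lt_of_mem ha hS
  have hins : ∀ s ∈ S, s = a ∨ s ∈ S \ {a} := fun s hs => by
    by_cases h : s = a
    · exact .inl h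
    · exact .inr ⟨hs, h⟩
  have hsub : S \ {a} ⊆ S := Set.sdiff_subset
  have hfin := hS.subset hsub
  by_cases ha0 : a = 0
  · exact .inr (.of (ha0 ▸ ha))
  obtain ⟨h₀, hh₀⟩ : ∃ h : Module.Dual K V, h a ≠ 0 := Module.Projective.exists_dual_ne_zero K ha0
  let h : V →ₗ[K] K := (h₀ a)⁻¹ • h₀
  have hha : h a = 1 := by simp [h, hh₀]
  -- The projection along `a` onto the kernel of `h`. The induction hypothesis is used both for `S \
  -- {a}` and for its image under `π`.
  let π : V →ₗ[K] V := LinearMap.id - h.smulRight a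
  have hπ : ∀ x, π x = x - h x • a := fun x => by simp [π]
  rcases ih _ hlt hfin rfl with ⟨f, hf⟩ | h0
  swap
  · exact .inr (h0.mono hsub)
  rcases ih _ (lt_of_le_of_lt (Set.ncard_image_le hfin (f := π)) hlt) (hfin.image π) rfl with
    ⟨g, hg⟩ | h0
  · left
    obtain ⟨M, -, hM⟩ := exists_pos_mul_add_pos hS (fun x => g (π x)) h (fun s hs => by
      rcases hins s hs with rfl | hs
      · right; simp [hπ, hha]
      · exact .inl (hg _ ⟨s, hs, rfl⟩))
    exact ⟨M • (g ∘ₗ π) + h, fun s hs => by simpa using hM s hs⟩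
  · obtain ⟨x, hx, hx0⟩ := h0.exists_of_image π
    -- Now `x = h x • a`. If `h x ≤ 0`, this gives a vanishing positive combination; if `h x > 0`,
    -- then `f x > 0` forces `f a > 0`.
    rw [hπ, sub_eq_zero] at hx0
    rcases lt_trichotomy (h x) 0 with ht | ht | ht
    · right
      have := (hx.mono hsub).add (.smul (neg_pos.2 ht) (.of ha))
      rwa [neg_smul, ← sub_eq_add_neg, sub_eq_zero.2 hx0] at this
    · right
      rw [ht, zero_smul] at hx0
      exact hx0 ▸ hx.mono hsub
    · left
      refine ⟨f, fun s hs => ?_⟩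
      rcases hins s hs with rfl | hs
      · have := hx.map_pos hf
        rw [hx0, map_smul, smul_eq_mul] at this
        exact pos_of_mul_pos_right this ht.le
      · exact hf s hs

theorem PosComb.exists_sum {S : Set V} {x : V} (hx : PosComb K S x) :
    ∃ (N : ℕ) (w : Fin N → V) (c : Fin N → K), 0 < N ∧ (∀ i, w i ∈ S) ∧ (∀ i, 0 < c i) ∧
      x = ∑ i, c i • w i := by
  induction hx with
  | of hx => exact ⟨1, fun _ => _, fun _ => 1, one_pos, fun _ => hx, fun _ => one_pos, by simp⟩
  | add _ _ h1 h2 =>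
    obtain ⟨N, w, c, hN, hw, hc, rfl⟩ := h1
    obtain ⟨N', w', c', hN', hw', hc', rfl⟩ := h2
    refine ⟨N + N', Fin.append w w', Fin.append c c', by omega, ?_, ?_, by simp [Fin.sum_univ_add]⟩
    · intro i; induction i using Fin.addCases <;> simp [hw, hw']
    · intro i; induction i using Fin.addCases <;> simp [hc, hc']
  | @smul d x hd _ h1 =>
    obtain ⟨N, w, c, hN, hw, hc, rfl⟩ := h1
    exact ⟨N, w, fun i => d * c i, hN, hw, fun i => mul_pos hd (hc i), by
      simp [Finset.smul_sum, mul_smul]⟩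

/-- Over the rationals, a multiple of a positive combination is a sum of generators. -/
theorem PosComb.exists_list_sum {V : Type*} [AddCommGroup V] [Module ℚ V] {S : Set V} {x : V}
    (hx : PosComb ℚ S x) :
    ∃ (d : ℕ) (M : List V), 0 < d ∧ M ≠ [] ∧ (∀ s ∈ M, s ∈ S) ∧ d • x = M.sum := by
  have rep : ∀ (k : ℕ) (M : List V), 0 < k → M ≠ [] → (∀ s ∈ M, s ∈ S) →
      ∃ M' : List V, M' ≠ [] ∧ (∀ s ∈ M', s ∈ S) ∧ k • M.sum = M'.sum := by
    intro k M hk hM hS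
    induction k, hk using Nat.le_induction with
    | base => exact ⟨M, hM, hS, by simp⟩
    | succ k hk ih =>
      obtain ⟨M', h1, h2, h3⟩ := ih
      refine ⟨M' ++ M, by simp [hM], fun s hs => ?_, by rw [succ_nsmul, h3, List.sum_append]⟩
      rcases List.mem_append.1 hs with hs | hs
      exacts [h2 s hs, hS s hs]
  induction hx with
  | @of x hx => exact ⟨1, [x], one_pos, by simp, by simpa using hx, by simp⟩
  | @add x y _ _ h1 h2 =>
    obtain ⟨d, M, hd, hM, hS, h⟩ := h1
    obtain ⟨e, M', he, hM', hS', h'⟩ := h2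
    obtain ⟨L, hL, hLS, hL'⟩ := rep e M he hM hS
    obtain ⟨L₂, -, hLS₂, hL₂'⟩ := rep d M' hd hM' hS'
    refine ⟨d * e, L ++ L₂, mul_pos hd he, by simp [hL], fun s hs => ?_, ?_⟩
    · rcases List.mem_append.1 hs with hs | hs
      exacts [hLS s hs, hLS₂ s hs]
    · rw [List.sum_append, ← hL', ← hL₂', ← h, ← h', smul_add, mul_nsmul, mul_comm d e, mul_nsmul]
  | @smul c x hc _ h1 =>
    obtain ⟨d, M, hd, hM, hS, h⟩ := h1
    obtain ⟨L, hL, hLS, hL'⟩ := rep c.num.toNat M (by simpa using hc) hM hS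
    -- With `c = num / den`, multiplying `c • x` by `den * d` gives `num` times `d • x`.
    refine ⟨c.den * d, L, mul_pos c.den_pos hd, hL, hLS, ?_⟩
    rw [← hL', ← h, ← Nat.cast_smul_eq_nsmul ℚ, ← Nat.cast_smul_eq_nsmul ℚ,
      ← Nat.cast_smul_eq_nsmul ℚ, smul_smul, smul_smul]
    congr 1
    have h1 : ((c.num.toNat : ℕ) : ℚ) = (c.num : ℚ) := by
      rw [← Int.cast_natCast, Int.toNat_of_nonneg (Rat.num_pos.2 hc).le]
    have h2 := Rat.mul_den_eq_num c
    rw [h1, ← h2]; push_cast; ring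

end Alternative

/-! ### Monotone utilities for ordinal data -/

/-- A bounded strictly increasing utility. -/
noncomputable def boundedUtility {n : ℕ} (x : Bundle n) : ℝ := 1 - 1 / (1 + ∑ i, (x i : ℝ))

theorem boundedUtility_strictMono {n : ℕ} : StrictMono (boundedUtility (n := n)) := by
  intro x y hxy
  have h0 : ∀ z : Bundle n, 0 ≤ ∑ i, (z i : ℝ) := fun z => Finset.sum_nonneg fun i _ => (z i).2
  have h : ∑ i, (x i : ℝ) < ∑ i, (y i : ℝ) := by
    obtain ⟨hle, i, hi⟩ := Pi.lt_def.1 hxy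
    exact Finset.sum_lt_sum (fun j _ => by exact_mod_cast hle j)
      ⟨i, Finset.mem_univ _, by exact_mod_cast hi⟩
  have := one_div_lt_one_div_of_lt (by linarith [h0 x]) (add_lt_add_right h 1)
  unfold boundedUtility
  linarith

theorem boundedUtility_nonneg {n : ℕ} (x : Bundle n) : 0 ≤ boundedUtility x := by
  have h0 : 0 ≤ ∑ i, (x i : ℝ) := Finset.sum_nonneg fun i _ => (x i).2
  have : 1 / (1 + ∑ i, (x i : ℝ)) ≤ 1 := by rw [div_le_one (by linarith)]; linarith
  unfold boundedUtility
  linarith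

theorem boundedUtility_lt_one {n : ℕ} (x : Bundle n) : boundedUtility x < 1 := by
  have h0 : 0 ≤ ∑ i, (x i : ℝ) := Finset.sum_nonneg fun i _ => (x i).2
  have : 0 < 1 / (1 + ∑ i, (x i : ℝ)) := by positivity
  unfold boundedUtility
  linarith

theorem Increasing.monotone {n : ℕ} {s : Sense} {u : Bundle n → ℝ} (h : Increasing s u) :
    Monotone u := by
  cases s
  exacts [h, StrictMono.monotone h]

theorem increasing_of_strictMono {n : ℕ} {u : Bundle n → ℝ} (h : StrictMono u) (s : Sense) :
    Increasing s u := by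
  cases s
  exacts [h.monotone, h]

/-- Finitely many observations are rationalized by an increasing utility if and only if they satisfy
monotone SARP. -/
theorem monotoneSARP_iff {n : ℕ} {ι : Type} [Finite ι] (x : ι → Bundle n)
    (B : ι → Set (Bundle n)) (hx : ∀ t, x t ∈ B t) (E : Set (Bundle n × Set (Bundle n)))
    (hE : ∀ o, o ∈ E ↔ ∃ t, o = (x t, B t)) (s : Sense) :
    MonotoneSARP E ↔ ∃ u : Bundle n → ℝ, Increasing s u ∧ ∀ t, IsArgmax u (B t) (x t) := by
  constructor
  · intro h
    let R : Bundle n → Bundle n → Prop := fun x y => DirectlyRevealed E x y ∨ y < x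
    let S : Bundle n → Set ι := fun z => {t | Relation.ReflTransGen R z (x t)}
    have hS : ∀ {y z}, R y z → S z ⊆ S y := fun hyz t ht => Relation.ReflTransGen.head hyz ht
    let u : Bundle n → ℝ := fun z => (S z).ncard + boundedUtility z
    have hu : StrictMono u := fun y z hyz => by
      have h1 : ((S y).ncard : ℝ) ≤ (S z).ncard := by
        exact_mod_cast Set.ncard_le_ncard (hS (Or.inr hyz)) (Set.toFinite _)
      have h2 := boundedUtility_strictMono hyz
      simp only [u]
      linarith
    refine ⟨u, increasing_of_strictMono hu s, fun t => ⟨hx t, fun y hy hne => ?_⟩⟩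
    have hR : R (x t) y := .inl ⟨B t, (hE _).2 ⟨t, rfl⟩, hy, hne⟩
    have hlt : (S y).ncard < (S (x t)).ncard := by
      -- The observation `t` itself is lost: reaching `x t` from `y` would close a cycle.
      refine Set.ncard_lt_ncard ((Set.ssubset_iff_of_subset (hS hR)).2
        ⟨t, Relation.ReflTransGen.refl, fun ht => ?_⟩) (Set.toFinite _)
      exact h (x t) (Relation.TransGen.head' hR ht)
    have h1 : ((S y).ncard : ℝ) + 1 ≤ (S (x t)).ncard := by exact_mod_cast hlt
    have h2 := boundedUtility_lt_one y
    have h3 := boundedUtility_nonneg (x t)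
    simp only [u]
    linarith
  · rintro ⟨u, hu, hmax⟩ z hz
    have hrev : ∀ {y z}, DirectlyRevealed E y z → u z < u y := by
      rintro y z ⟨B', hB', hz, hne⟩
      obtain ⟨t, ht⟩ := (hE _).1 hB'
      obtain ⟨rfl, rfl⟩ := Prod.mk.inj ht
      exact (hmax t).2 z hz hne
    -- A weakly increasing `u` need not fall along dominance, so paths made of dominance alone are
    -- kept as a separate case.
    have key : ∀ w, Relation.TransGen (fun x y => DirectlyRevealed E x y ∨ y < x) z w →
        u w < u z ∨ w < z := by
      intro w hw
      have aux : ∀ {a b}, a < b → u a ≤ u b := fun h => hu.monotone h.le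
      induction hw with
      | single h =>
        rcases h with h | h
        exacts [.inl (hrev h), .inr h]
      | tail _ h ih =>
        rcases h with h | h <;> rcases ih with ih | ih
        · exact .inl ((hrev h).trans ih)
        · exact .inl ((hrev h).trans_le (aux ih))
        · exact .inl ((aux h).trans_lt ih)
        · exact .inr (h.trans ih)
    rcases key z hz with h | h <;> exact lt_irrefl _ h

/-- For undominated data with free disposal, monotone SARP is no stronger than SARP. -/
theorem sarp_iff_monotoneSARP {n : ℕ} {E : Set (Bundle n × Set (Bundle n))}
    (hfd : FreeDisposal E) (hud : Undominated E) : SARP E ↔ MonotoneSARP E := by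
  -- Free disposal makes `z` feasible, and `z = x` would let `y` dominate the choice `x`.
  have down : ∀ {x y z}, DirectlyRevealed E x y → z ≤ y → DirectlyRevealed E x z := by
    rintro x y z ⟨B, hB, hy, hne⟩ hzy
    refine ⟨B, hB, hfd x B hB hzy hy, ?_⟩
    rintro rfl
    exact hne (hud _ B hB y hy hzy)
  constructor
  · intro h x hx
    -- Only dominance steps at the start of a path have no revealed step to absorb them; they are
    -- recorded as `z ≤ x`.
    have key : ∀ y, Relation.TransGen (fun x y => DirectlyRevealed E x y ∨ y < x) x y →
        y < x ∨ ∃ z ≤ x, Relation.TransGen (DirectlyRevealed E) z y := by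
      intro y hy
      induction hy with
      | single h =>
        rcases h with h | h
        exacts [.inr ⟨x, le_rfl, .single h⟩, .inl h]
      | tail _ h ih =>
        rcases h with h | h <;> rcases ih with ih | ⟨z, hz, hzy⟩
        · exact .inr ⟨_, ih.le, .single h⟩
        · exact .inr ⟨z, hz, hzy.tail h⟩
        · exact .inl (h.trans ih)
        · refine .inr ⟨z, hz, ?_⟩
          cases hzy with
          | single h' => exact .single (down h' h.le)
          | tail h1 h' => exact h1.tail (down h' h.le)
    rcases key x hx with h' | ⟨z, hz, hzx⟩
    · exact lt_irrefl _ h'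
    · refine h z ?_
      cases hzx with
      | single h' => exact .single (down h' hz)
      | tail h1 h' => exact h1.tail (down h' hz)
  · intro h x hx
    exact h x (Relation.TransGen.mono (fun _ _ h => Or.inl h) _ _ hx)

theorem DataSet.monotoneSARP_BB_iff {n : ℕ} (D : DataSet n) (s : Sense) :
    MonotoneSARP D.BB ↔ D.RationalizableBB s :=
  monotoneSARP_iff D.xTot D.BTot (fun t => ⟨D.x t, D.x_mem t, rfl⟩) _ (fun _ => Iff.rfl) s

theorem DataSet.monotoneSARP_NB_iff {n : ℕ} (D : DataSet n) (s : Sense) :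
    MonotoneSARP D.NB ↔ D.RationalizableNB s := by
  rw [monotoneSARP_iff (ι := Σ t, Fin (D.K t)) (fun i => D.x i.1 i.2) (fun i => D.B i.1 i.2)
    (fun i => D.x_mem i.1 i.2) D.NB (by simp [DataSet.NB]) s]
  simp only [DataSet.RationalizableNB, Sigma.forall]

/-! ### Linear utilities for lottery data -/

/-- `f` is a linear utility that ranks every chosen lottery above the rejected ones. -/
def StrictlyRepresents {n : ℕ} (f : (Bundle n →₀ ℝ) →ₗ[ℝ] ℝ)
    (E : Set ((Bundle n →₀ ℝ) × Set (Bundle n →₀ ℝ))) : Prop :=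
  ∀ p q, LotteryRevealed E p q → f q < f p

/-- Mixing with `r` adds the same amount to both values, and `θ > 0` cancels. -/
theorem MixtureDecomposition.map_le {n : ℕ} {Y : Finset (Bundle n)}
    {E : Set ((Bundle n →₀ ℝ) × Set (Bundle n →₀ ℝ))} {p q : Bundle n →₀ ℝ} {N : ℕ}
    {ps qs : Fin N → Bundle n →₀ ℝ} (h : MixtureDecomposition Y E p q ps qs)
    {f : (Bundle n →₀ ℝ) →ₗ[ℝ] ℝ} (hf : StrictlyRepresents f E) :
    f q ≤ f p ∧ ((∃ i, LotteryRevealed E (ps i) (qs i)) → f q < f p) := by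
  obtain ⟨r, -, θ, hθ, -, c, -, -, hc, -, hp, hq, hpq⟩ := h
  have hp' := congrArg f hp
  have hq' := congrArg f hq
  simp only [map_add, map_smul, map_sum, smul_eq_mul] at hp' hq'
  have hle : ∀ i, c i * f (qs i) ≤ c i * f (ps i) := fun i => by
    refine mul_le_mul_of_nonneg_left ?_ (hc i).le
    rcases hpq i with h | h
    · exact (hf _ _ h).le
    · rw [h]
  constructor
  · have := Finset.sum_le_sum fun i (_ : i ∈ Finset.univ) => hle i
    exact le_of_mul_le_mul_left (by linarith) hθ
  · rintro ⟨i, hi⟩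
    have := Finset.sum_lt_sum (fun i (_ : i ∈ Finset.univ) => hle i)
      ⟨i, Finset.mem_univ i, mul_lt_mul_of_pos_left (hf _ _ hi) (hc i)⟩
    exact lt_of_mul_lt_mul_left (by linarith) hθ.le

theorem StrictlyRepresents.larp {n : ℕ} (Y : Finset (Bundle n))
    {E : Set ((Bundle n →₀ ℝ) × Set (Bundle n →₀ ℝ))} {f : (Bundle n →₀ ℝ) →ₗ[ℝ] ℝ}
    (hf : StrictlyRepresents f E) : LARP Y E := by
  rintro p - q - ⟨N, ps, qs, h⟩ ⟨N', ps', qs', h', hex⟩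
  exact absurd ((h'.map_le hf).2 hex) (not_lt.2 (h.map_le hf).1)

theorem sum_smul_mem_lotteries {n : ℕ} {Y : Finset (Bundle n)} {N : ℕ}
    {ps : Fin N → Bundle n →₀ ℝ} (hps : ∀ i, ps i ∈ lotteries Y) {c : Fin N → ℝ}
    (hc : ∀ i, 0 ≤ c i) (h1 : ∑ i, c i = 1) : ∑ i, c i • ps i ∈ lotteries Y := by
  let T : (Bundle n →₀ ℝ) →ₗ[ℝ] ℝ := Finsupp.linearCombination ℝ fun _ => (1 : ℝ)
  have hT : ∀ p, T p = p.sum fun _ w => w := fun p => by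
    simp [T, Finsupp.linearCombination_apply]
  refine ⟨fun y => ?_, ?_, ?_⟩
  · rw [Finsupp.finsetSum_apply]
    exact Finset.sum_nonneg fun i _ => mul_nonneg (hc i) ((hps i).1 y)
  · intro y hy
    by_contra hY
    refine Finsupp.mem_support_iff.1 hy ?_
    rw [Finsupp.finsetSum_apply]
    refine Finset.sum_eq_zero fun i _ => ?_
    have : ps i y = 0 := Finsupp.notMem_support_iff.1 fun h => hY ((hps i).2.1 h)
    simp [this]
  · rw [← hT, map_sum, ← h1]
    refine Finset.sum_congr rfl fun i _ => ?_
    rw [map_smul, hT, (hps i).2.2, smul_eq_mul, mul_one]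

/-- If Gordan's alternative gives a vanishing combination of the differences, normalizing its
weights produces one lottery that is strictly revealed preferred to itself. -/
theorem exists_strictlyRepresents_of_larp {n : ℕ} {Y : Finset (Bundle n)}
    {E : Set ((Bundle n →₀ ℝ) × Set (Bundle n →₀ ℝ))}
    (hfin : {d | ∃ p q, LotteryRevealed E p q ∧ d = p - q}.Finite)
    (hY : ∀ p q, LotteryRevealed E p q → p ∈ lotteries Y ∧ q ∈ lotteries Y)
    (h : LARP Y E) : ∃ f, StrictlyRepresents f E := by
  rcases exists_pos_functional_or_posComb_zero (K := ℝ) hfin with ⟨f, hf⟩ | h0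
  · refine ⟨f, fun p q hpq => ?_⟩
    have := hf _ ⟨p, q, hpq, rfl⟩
    rw [map_sub] at this
    linarith
  · exfalso
    obtain ⟨N, w, c, hN, hw, hc, hsum⟩ := h0.exists_sum
    choose ps qs hpq hd using hw
    have hC : 0 < ∑ i, c i := Finset.sum_pos (fun i _ => hc i) ⟨⟨0, hN⟩, Finset.mem_univ _⟩
    let d : Fin N → ℝ := fun i => c i / ∑ i, c i
    have hd0 : ∀ i, 0 < d i := fun i => div_pos (hc i) hC
    have hd1 : ∑ i, d i = 1 := by simp only [d, ← Finset.sum_div]; exact div_self hC.ne'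
    have hp := sum_smul_mem_lotteries (fun i => (hY _ _ (hpq i)).1) (fun i => (hd0 i).le) hd1
    have heq : ∑ i, d i • ps i = ∑ i, d i • qs i := by
      rw [← sub_eq_zero, ← Finset.sum_sub_distrib]
      have : ∀ i, d i • ps i - d i • qs i = (∑ i, c i)⁻¹ • (c i • w i) := fun i => by
        rw [hd, ← smul_sub, smul_smul]
        congr 1
        simp only [d]; ring
      simp only [this, ← Finset.smul_sum, ← hsum, smul_zero]
    -- The weak relation holds by the one-term decomposition, the strict one by the normalized
    -- combination.
    refine h _ hp _ hp ⟨1, fun _ => ∑ i, d i • ps i, fun _ => ∑ i, d i • ps i, ?_⟩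
      ⟨N, ps, qs, ?_, ⟨0, hN⟩, hpq _⟩
    · exact ⟨_, hp, 1, one_pos, le_rfl, fun _ => 1, fun _ => hp, fun _ => hp, fun _ => one_pos,
        by simp, by simp, by simp, fun _ => .inr rfl⟩
    · exact ⟨_, hp, 1, one_pos, le_rfl, d, fun i => (hY _ _ (hpq i)).1,
        fun i => (hY _ _ (hpq i)).2, hd0, hd1, by simp, by simpa using heq, fun i => .inl (hpq i)⟩

theorem map_lottery {n : ℕ} (f : (Bundle n →₀ ℝ) →ₗ[ℝ] ℝ) (α : ℝ) (y y' : Bundle n) :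
    f (lottery α y y') = α * f (Finsupp.single y 1) + (1 - α) * f (Finsupp.single y' 1) := by
  have h : ∀ (z : Bundle n) (a : ℝ), f (Finsupp.single z a) = a * f (Finsupp.single z 1) :=
    fun z a => by rw [← smul_eq_mul, ← map_smul, Finsupp.smul_single, smul_eq_mul, mul_one]
  rw [lottery, map_add, h y, h y']

theorem lottery_mem_lotteries {n : ℕ} {α : ℝ} (h0 : 0 ≤ α) (h1 : α ≤ 1) {Y : Finset (Bundle n)}
    {y y' : Bundle n} (h : (lottery α y y').support ⊆ Y) : lottery α y y' ∈ lotteries Y := by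
  classical
  refine ⟨fun z => ?_, h, ?_⟩
  · rw [lottery, Finsupp.add_apply, Finsupp.single_apply, Finsupp.single_apply]
    split_ifs <;> linarith
  · rw [lottery, Finsupp.sum_add_index' (fun _ => rfl) (fun _ _ _ => rfl)]
    rw [Finsupp.sum_single_index rfl, Finsupp.sum_single_index rfl]
    ring

theorem lottery_support_subset {n : ℕ} {α : ℝ} {Y : Finset (Bundle n)}
    {y y' : Bundle n} (h : y ∈ Y) (h' : y' ∈ Y) : (lottery α y y').support ⊆ Y := by
  classical
  refine Finsupp.support_add.trans (Finset.union_subset ?_ ?_)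
  · exact Finsupp.support_single_subset.trans (Finset.singleton_subset_iff.2 h)
  · exact Finsupp.support_single_subset.trans (Finset.singleton_subset_iff.2 h')

/-- A chosen lottery that equals one whose outcomes lie below `x` and `x + o`. -/
theorem le_of_lottery_eq {n : ℕ} {α : ℝ} {a o x y y' : Bundle n}
    (h : lottery α y y' = lottery α a (o + a)) (hy : y ≤ x) (hy' : y' ≤ x + o) : a ≤ x := by
  classical
  by_cases e : y = a
  · exact e ▸ hy
  by_cases e' : y' = o + a
  · rw [e', add_comm x] at hy'
    exact le_of_add_le_add_left hy'
  by_cases e₂ : y = o + a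
  · exact (le_add_of_nonneg_left zero_le).trans (e₂ ▸ hy)
  -- The left lottery has no mass at `o + a`, which forces `α = 1` and `a ≠ o + a`; then the masses
  -- at `a` are 0 and 1.
  exfalso
  have ha := DFunLike.congr_fun h a
  have hoa := DFunLike.congr_fun h (o + a)
  simp only [lottery, Finsupp.add_apply, Finsupp.single_apply, if_neg e, if_neg e', if_neg e₂,
    if_true] at ha hoa
  split_ifs at ha hoa <;> linarith

/-! ### Partial-narrow bracketing and linear utilities -/

namespace DataSet

variable {n : ℕ} (D : DataSet n)

theorem xTot_eq (t : Fin D.T) (k : Fin (D.K t)) : D.xTot t = D.xOther t k + D.x t k :=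
  (Finset.sum_erase_add _ _ (Finset.mem_univ k)).symm

theorem lotteryRevealed_iff {α : ℝ} {Y : Finset (Bundle n)} {p q : Bundle n →₀ ℝ} :
    LotteryRevealed (D.lotteryData α Y) p q ↔
      ∃ t k, p = D.lotteryChoice α t k ∧ q ∈ D.lotteryBudget α Y t k ∧ q ≠ p := by
  constructor
  · rintro ⟨Q, ⟨t, k, h⟩, hq, hne⟩
    obtain ⟨rfl, rfl⟩ := Prod.mk.inj h
    exact ⟨t, k, rfl, hq, hne⟩
  · rintro ⟨t, k, rfl, hq, hne⟩
    exact ⟨_, ⟨t, k, rfl⟩, hq, hne⟩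

/-- The sets `B` may be infinite, but budget lotteries are indexed by pairs from the finite set `Y`.
-/
theorem finite_lotteryRevealed_sub (α : ℝ) (Y : Finset (Bundle n)) :
    {d | ∃ p q, LotteryRevealed (D.lotteryData α Y) p q ∧ d = p - q}.Finite := by
  refine (Set.finite_range fun i : (Σ t, Fin (D.K t)) × Y × Y =>
    D.lotteryChoice α i.1.1 i.1.2 - lottery α (i.2.1 : Bundle n) i.2.2).subset ?_
  rintro d ⟨p, q, h, rfl⟩
  obtain ⟨t, k, rfl, ⟨y, hy, y', hy', rfl, -⟩, -⟩ := D.lotteryRevealed_iff.1 h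
  exact ⟨⟨⟨t, k⟩, ⟨y, hy⟩, ⟨y', hy'⟩⟩, rfl⟩

theorem mem_lotteries_of_lotteryRevealed {α : ℝ} (h0 : 0 ≤ α) (h1 : α ≤ 1)
    {Y : Finset (Bundle n)} (hY : D.Supports α Y) {p q : Bundle n →₀ ℝ}
    (h : LotteryRevealed (D.lotteryData α Y) p q) : p ∈ lotteries Y ∧ q ∈ lotteries Y := by
  obtain ⟨t, k, rfl, ⟨y, hy, y', hy', rfl, -⟩, -⟩ := D.lotteryRevealed_iff.1 h
  exact ⟨lottery_mem_lotteries h0 h1 (hY.2 t k),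
    lottery_mem_lotteries h0 h1 (lottery_support_subset hy hy')⟩

theorem larp_iff {α : ℝ} (h0 : 0 ≤ α) (h1 : α ≤ 1) {Y : Finset (Bundle n)}
    (hY : D.Supports α Y) :
    LARP Y (D.lotteryData α Y) ↔ ∃ f, StrictlyRepresents f (D.lotteryData α Y) :=
  ⟨exists_strictlyRepresents_of_larp (D.finite_lotteryRevealed_sub α Y) fun _ _ =>
    D.mem_lotteries_of_lotteryRevealed h0 h1 hY, fun ⟨_, hf⟩ => hf.larp Y⟩

theorem RationalizablePNB.undominated {D : DataSet n} {s : Sense} {α : ℝ} (h0 : 0 ≤ α)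
    (h1 : α ≤ 1) (h : D.RationalizablePNB s α) : Undominated D.NB := by
  obtain ⟨u, hu, hmax⟩ := h
  rintro x B ⟨t, k, hxB⟩ y hy hxy
  obtain ⟨rfl, rfl⟩ := Prod.mk.inj hxB
  by_contra hne
  have hlt := (hmax t k).2 y hy hne
  have h2 := mul_le_mul_of_nonneg_left (hu.monotone hxy) h0
  have h3 := mul_le_mul_of_nonneg_left (hu.monotone (add_le_add_right hxy (D.xOther t k)))
    (sub_nonneg.2 h1)
  simp only at hlt
  linarith

/-- Disposal of goods may leave a weakly increasing `u` unchanged. The functional is therefore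
lexicographic in effect: a large multiple of the expectation of `u`, plus the expectation of
`boundedUtility`. -/
theorem RationalizablePNB.exists_strictlyRepresents {D : DataSet n} {s : Sense} {α : ℝ}
    (h0 : 0 ≤ α) (h1 : α ≤ 1) (h : D.RationalizablePNB s α) (Y : Finset (Bundle n)) :
    ∃ f, StrictlyRepresents f (D.lotteryData α Y) := by
  obtain ⟨u, hu, hmax⟩ := h
  let F : (Bundle n →₀ ℝ) →ₗ[ℝ] ℝ := Finsupp.linearCombination ℝ u
  let G : (Bundle n →₀ ℝ) →ₗ[ℝ] ℝ := Finsupp.linearCombination ℝ boundedUtility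
  have hF : ∀ y y', F (lottery α y y') = α * u y + (1 - α) * u y' := fun y y' => by
    simp [F, map_lottery]
  have hG : ∀ y y', G (lottery α y y') = α * boundedUtility y + (1 - α) * boundedUtility y' :=
    fun y y' => by simp [G, map_lottery]
  obtain ⟨M, -, hM⟩ := exists_pos_mul_add_pos (D.finite_lotteryRevealed_sub α Y) F G (by
    rintro _ ⟨p, q, hpq, rfl⟩
    obtain ⟨t, k, rfl, ⟨y, -, y', -, rfl, x, hx, hyx, hyx'⟩, hne⟩ := D.lotteryRevealed_iff.1 hpq
    have h1' := sub_nonneg.2 h1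
    rw [add_comm] at hyx'
    have hle₁ := mul_le_mul_of_nonneg_left (hu.monotone hyx) h0
    have hle₂ := mul_le_mul_of_nonneg_left (hu.monotone hyx') h1'
    rw [lotteryChoice, map_sub, map_sub, hF, hF, hG, hG]
    by_cases hxx : x = D.x t k
    · subst hxx
      rw [← D.xTot_eq] at hyx' hle₂
      have hlt : α * boundedUtility y + (1 - α) * boundedUtility y' <
          α * boundedUtility (D.x t k) + (1 - α) * boundedUtility (D.xTot t) := by
        have hg₁ := mul_le_mul_of_nonneg_left (boundedUtility_strictMono.monotone hyx) h0
        have hg₂ := mul_le_mul_of_nonneg_left (boundedUtility_strictMono.monotone hyx') h1'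
        -- Otherwise both terms tie, so each outcome either coincides with the chosen one or has
        -- weight zero, and the lotteries are equal.
        by_contra hnot
        apply hne
        have e₁ : α * boundedUtility y = α * boundedUtility (D.x t k) := by linarith
        have e₂ : (1 - α) * boundedUtility y' = (1 - α) * boundedUtility (D.xTot t) := by
          linarith
        rw [lotteryChoice, lottery, lottery]
        congr 1
        · rcases mul_eq_mul_left_iff.1 e₁ with e | e
          · rw [hyx.eq_or_lt.resolve_right fun h => (boundedUtility_strictMono h).ne e]
          · simp [e]
        · rcases mul_eq_mul_left_iff.1 e₂ with e | e
          · rw [hyx'.eq_or_lt.resolve_right fun h => (boundedUtility_strictMono h).ne e]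
          · simp [e]
      rcases (show α * u y + (1 - α) * u y' ≤ α * u (D.x t k) + (1 - α) * u (D.xTot t) by
        linarith).eq_or_lt with h | h
      · right; constructor <;> linarith
      · left; linarith
    · left
      have hlt := (hmax t k).2 x hx hxx
      simp only [← D.xTot_eq] at hlt
      linarith)
  refine ⟨M • F + G, fun p q hpq => ?_⟩
  have := hM _ ⟨p, q, hpq, rfl⟩
  simp only [map_sub, LinearMap.add_apply, LinearMap.smul_apply, smul_eq_mul] at this ⊢
  linarith

/-- The functional only matters on `Y` and need not be monotone there. The maximum `w` over elements
of `Y` below a bundle repairs this; `0 ∈ Y` makes it well defined. -/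
theorem rationalizablePNB_of_strictlyRepresents {D : DataSet n} {α : ℝ} (h0 : 0 ≤ α) (h1 : α ≤ 1)
    {Y : Finset (Bundle n)} (hY : D.Supports α Y) (hud : Undominated D.NB)
    {f : (Bundle n →₀ ℝ) →ₗ[ℝ] ℝ} (hf : StrictlyRepresents f (D.lotteryData α Y)) (s : Sense) :
    D.RationalizablePNB s α := by
  classical
  let v : Bundle n → ℝ := fun y => f (Finsupp.single y 1)
  have hne : ∀ x : Bundle n, (Y.filter (· ≤ x)).Nonempty := fun x =>
    ⟨0, Finset.mem_filter.2 ⟨hY.1, zero_le⟩⟩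
  let w : Bundle n → ℝ := fun x => (Y.filter (· ≤ x)).sup' (hne x) v
  have hw : Monotone w := fun a b hab => Finset.sup'_mono _ (fun y hy => by
    rw [Finset.mem_filter] at hy ⊢
    exact ⟨hy.1, hy.2.trans hab⟩) (hne a)
  have hwv : ∀ y ∈ Y, v y ≤ w y := fun y hy =>
    Finset.le_sup' (s := Y.filter (· ≤ y)) v (Finset.mem_filter.2 ⟨hy, le_rfl⟩)
  have hwex : ∀ x, ∃ y ∈ Y, y ≤ x ∧ w x = v y := fun x => by
    obtain ⟨y, hy, h⟩ := Finset.exists_mem_eq_sup' (hne x) v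
    rw [Finset.mem_filter] at hy
    exact ⟨y, hy.1, hy.2, h⟩
  -- The constant -1 makes each revealed gap exceed 1 after scaling, more than `boundedUtility` can
  -- offset.
  obtain ⟨M, hM0, hM⟩ := exists_pos_mul_add_pos (D.finite_lotteryRevealed_sub α Y) f
    (fun _ => -1) (by
      rintro _ ⟨p, q, hpq, rfl⟩
      left
      have := hf _ _ hpq
      rw [map_sub]; linarith)
  let u : Bundle n → ℝ := fun x => M * w x + boundedUtility x
  have hu : StrictMono u := fun a b hab => by
    have h1 := mul_le_mul_of_nonneg_left (hw hab.le) hM0.le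
    have h2 := boundedUtility_strictMono hab
    simp only [u]; linarith
  refine ⟨u, increasing_of_strictMono hu s, fun t k => ⟨D.x_mem t k, fun x hx hxx => ?_⟩⟩
  have h1' := sub_nonneg.2 h1
  obtain ⟨y, hyY, hyx, hwy⟩ := hwex x
  obtain ⟨y', hyY', hyx', hwy'⟩ := hwex (D.xOther t k + x)
  rw [add_comm] at hyx'
  -- The lottery over the maximizers `y`, `y'` is affordable. Were it the chosen one, `x` would
  -- dominate the choice.
  have hrev : LotteryRevealed (D.lotteryData α Y) (D.lotteryChoice α t k) (lottery α y y') := by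
    refine D.lotteryRevealed_iff.2 ⟨t, k, rfl, ⟨y, hyY, y', hyY', rfl, x, hx, hyx, hyx'⟩,
      fun h => hxx ?_⟩
    rw [lotteryChoice, D.xTot_eq t k] at h
    exact hud _ _ ⟨t, k, rfl⟩ x hx (le_of_lottery_eq h hyx hyx')
  have hlt := hM _ ⟨_, _, hrev, rfl⟩
  have hchoice : f (D.lotteryChoice α t k) ≤ α * w (D.x t k) + (1 - α) * w (D.xTot t) := by
    have hsupp := hY.2 t k
    -- An outcome of weight zero may lie outside `Y`, but its term vanishes.
    have hval : ∀ (a : ℝ) (b : Bundle n), 0 ≤ a → (a ≠ 0 → b ∈ Y) → a * v b ≤ a * w b :=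
      fun a b ha hb => by
        by_cases h : a = 0
        · simp [h]
        · exact mul_le_mul_of_nonneg_left (hwv b (hb h)) ha
    rw [lotteryChoice] at hsupp ⊢
    rw [map_lottery]
    refine add_le_add (hval _ _ h0 fun h => hsupp ?_) (hval _ _ h1' fun h => hsupp ?_) <;>
    · rw [Finsupp.mem_support_iff, lottery, Finsupp.add_apply, Finsupp.single_apply,
        Finsupp.single_apply]
      rw [if_pos rfl]
      split_ifs
      · linarith
      · simpa using h
  have b₁ := mul_le_mul_of_nonneg_left (boundedUtility_lt_one x).le h0
  have b₂ := mul_le_mul_of_nonneg_left (boundedUtility_lt_one (D.xOther t k + x)).le h1'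
  have b₃ := mul_nonneg h0 (boundedUtility_nonneg (D.x t k))
  have b₄ := mul_nonneg h1' (boundedUtility_nonneg (D.xTot t))
  have hmul := mul_le_mul_of_nonneg_left hchoice hM0.le
  rw [map_sub, map_lottery f α y y'] at hlt
  simp only [u, ← D.xTot_eq, hwy, hwy', v]
  nlinarith

theorem rationalizablePNB_iff {α : ℝ} (h0 : 0 ≤ α) (h1 : α ≤ 1) {Y : Finset (Bundle n)}
    (hY : D.Supports α Y) (s : Sense) :
    D.RationalizablePNB s α ↔
      Undominated D.NB ∧ ∃ f, StrictlyRepresents f (D.lotteryData α Y) :=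
  ⟨fun h => ⟨h.undominated h0 h1, h.exists_strictlyRepresents h0 h1 Y⟩,
    fun ⟨hud, _, hf⟩ => rationalizablePNB_of_strictlyRepresents h0 h1 hY hud hf s⟩

end DataSet

/-! ### The algorithm -/

/-- A comparison of two lotteries over numbered outcomes with integer weights: `(w, e, e')` says that
`w.1` units of outcome `e.1` and `w.2` units of `e.2` are better than `w.1` units of `e'.1` and
`w.2` units of `e'.2`. -/
abbrev Comparison := (ℕ × ℕ) × (ℕ × ℕ) × (ℕ × ℕ)

/-- The weight on outcome `k` in the lottery `e` with weights `w`. -/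
def mass (w e : ℕ × ℕ) (k : ℕ) : ℕ :=
  (if e.1 = k then w.1 else 0) + (if e.2 = k then w.2 else 0)

/-- The outcomes that occur in a comparison. -/
def indices (m : Comparison) : List ℕ := [m.2.1.1, m.2.1.2, m.2.2.1, m.2.2.2]

/-- The left and the right lotteries of the comparisons in `M` have the same total weights. -/
def Balanced (M : List Comparison) : Prop :=
  ∀ k ∈ M.flatMap indices,
    (M.map fun m => mass m.1 m.2.1 k).sum = (M.map fun m => mass m.1 m.2.2 k).sum

instance : DecidablePred Balanced := fun _ => inferInstanceAs (Decidable (∀ _ ∈ _, _))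

/-- The comparisons of different lotteries that a coded data set reveals. -/
def comparisons (c : Code) : List Comparison :=
  (c.2.2.flatMap fun o => o.2.map fun e => ((c.1.1, c.1.2 - c.1.1), o.1, e)).filter
    fun m => ¬ Balanced [m]

/-- The weighted value of a lottery if `v` lists the values of the outcomes. -/
def value (v : List ℕ) (w e : ℕ × ℕ) : ℕ := w.1 * v.getD e.1 0 + w.2 * v.getD e.2 0

/-- A list of values agrees with a comparison. -/
def Agrees (m : Comparison) (v : List ℕ) : Prop := value v m.1 m.2.2 < value v m.1 m.2.1

/-- `M` is a nonempty balanced list of comparisons taken from the coded data set. -/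
def IsObstruction (c : Code) (M : List Comparison) : Prop :=
  M ≠ [] ∧ (∀ m ∈ M, m ∈ comparisons c) ∧ Balanced M

/-- Some list of values agrees with all the comparisons of a coded data set. -/
def Feasible (c : Code) : Prop := ∃ v : List ℕ, ∀ m ∈ comparisons c, Agrees m v

/-! ### Enumerating the two kinds of certificates -/

section Computability

variable {α β : Type*} [Primcodable α] [Primcodable β]

/-- An unbounded search through the codes of `β` halts exactly when a witness exists. -/
theorem rePred_exists {P : α → β → Prop} (hP : PrimrecRel P) : REPred fun a => ∃ b, P a b := by
  classical
  have h : Computable₂ fun (a : α) (n : ℕ) =>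
      (Encodable.decode (α := β) n).bind fun b => if P a b then some () else none := by
    refine Primrec.to_comp (α := α × ℕ) (Primrec.option_bind (Primrec.decode.comp Primrec.snd) ?_)
    exact Primrec.ite (PrimrecRel.comp hP (Primrec.fst.comp Primrec.fst) Primrec.snd)
      (Primrec.const _) (Primrec.const _)
  refine (Partrec.rfindOpt h).dom_re.of_eq fun a => ?_
  rw [Nat.rfindOpt_dom]
  constructor
  · rintro ⟨n, x, hx⟩
    obtain ⟨b, -, hb⟩ := Option.bind_eq_some_iff.1 hx
    exact ⟨b, by by_contra hn; simp [hn] at hb⟩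
  · rintro ⟨b, hb⟩
    exact ⟨Encodable.encode b, (), by simp [hb]⟩

theorem primrec_list_sum {f : α → List ℕ} (hf : Primrec f) : Primrec fun a => (f a).sum :=
  Primrec.list_foldr hf (Primrec.const 0)
    (Primrec.nat_add.comp (Primrec.fst.comp Primrec.snd) (Primrec.snd.comp Primrec.snd)).to₂

theorem primrec_mass {w e : α → ℕ × ℕ} {k : α → ℕ} (hw : Primrec w) (he : Primrec e)
    (hk : Primrec k) : Primrec fun a => mass (w a) (e a) (k a) :=
  Primrec.nat_add.comp
    (Primrec.ite (Primrec.eq.comp (Primrec.fst.comp he) hk) (Primrec.fst.comp hw)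
      (Primrec.const 0))
    (Primrec.ite (Primrec.eq.comp (Primrec.snd.comp he) hk) (Primrec.snd.comp hw)
      (Primrec.const 0))

theorem primrec_indices : Primrec indices := by
  have h : ∀ {f : Comparison → ℕ} {g : Comparison → List ℕ}, Primrec f → Primrec g →
      Primrec fun m => f m :: g m := fun hf hg => Primrec.list_cons.comp hf hg
  have h1 : Primrec fun m : Comparison => m.2.1 := Primrec.fst.comp Primrec.snd
  have h2 : Primrec fun m : Comparison => m.2.2 := Primrec.snd.comp Primrec.snd
  exact h (Primrec.fst.comp h1) (h (Primrec.snd.comp h1) (h (Primrec.fst.comp h2)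
    (h (Primrec.snd.comp h2) (Primrec.const []))))

theorem primrecPred_balanced : PrimrecPred Balanced := by
  have hsum : ∀ g : Comparison → ℕ × ℕ, Primrec g →
      Primrec fun x : ℕ × List Comparison => (x.2.map fun m => mass m.1 (g m) x.1).sum := by
    intro g hg
    refine primrec_list_sum (Primrec.list_map Primrec.snd ?_)
    exact primrec_mass (Primrec.fst.comp Primrec.snd) (hg.comp Primrec.snd)
      (Primrec.fst.comp Primrec.fst)
  have hR : PrimrecRel fun (k : ℕ) (M : List Comparison) =>
      (M.map fun m => mass m.1 m.2.1 k).sum = (M.map fun m => mass m.1 m.2.2 k).sum :=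
    Primrec.eq.comp (hsum (fun m => m.2.1) (Primrec.fst.comp Primrec.snd))
      (hsum (fun m => m.2.2) (Primrec.snd.comp Primrec.snd))
  exact PrimrecRel.comp hR.forall_mem_list
    (Primrec.list_flatMap Primrec.id (primrec_indices.comp Primrec.snd).to₂) Primrec.id

theorem primrec_comparisons : Primrec comparisons := by
  have hp : PrimrecPred fun m : Comparison => ¬ Balanced [m] :=
    (primrecPred_balanced.comp (Primrec.list_cons.comp Primrec.id (Primrec.const []))).not
  refine (Primrec.listFilter hp).comp ?_
  refine Primrec.list_flatMap (Primrec.snd.comp Primrec.snd) ?_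
  refine Primrec.list_map (Primrec.snd.comp Primrec.snd) ?_
  have hc : Primrec fun x : (Code × ((ℕ × ℕ) × List (ℕ × ℕ))) × (ℕ × ℕ) => x.1.1.1 :=
    Primrec.fst.comp (Primrec.fst.comp Primrec.fst)
  exact Primrec.pair (Primrec.pair (Primrec.fst.comp hc)
    (Primrec.nat_sub.comp (Primrec.snd.comp hc) (Primrec.fst.comp hc)))
    (Primrec.pair (Primrec.fst.comp (Primrec.snd.comp Primrec.fst)) Primrec.snd)

theorem primrecRel_agrees : PrimrecRel Agrees := by
  have h : ∀ g : Comparison → ℕ × ℕ, Primrec g →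
      Primrec fun x : Comparison × List ℕ => value x.2 x.1.1 (g x.1) := by
    intro g hg
    have hw : Primrec fun x : Comparison × List ℕ => x.1.1 := Primrec.fst.comp Primrec.fst
    have hg' : Primrec fun x : Comparison × List ℕ => g x.1 := hg.comp Primrec.fst
    exact Primrec.nat_add.comp
      (Primrec.nat_mul.comp (Primrec.fst.comp hw)
        ((Primrec.list_getD 0).comp Primrec.snd (Primrec.fst.comp hg')))
      (Primrec.nat_mul.comp (Primrec.snd.comp hw)
        ((Primrec.list_getD 0).comp Primrec.snd (Primrec.snd.comp hg')))
  exact Primrec.nat_lt.comp (h (fun m => m.2.2) (Primrec.snd.comp Primrec.snd))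
    (h (fun m => m.2.1) (Primrec.fst.comp Primrec.snd))

theorem rePred_feasible : REPred Feasible :=
  rePred_exists (P := fun c v => ∀ m ∈ comparisons c, Agrees m v)
    (PrimrecRel.comp primrecRel_agrees.forall_mem_list (primrec_comparisons.comp Primrec.fst)
      Primrec.snd)

theorem rePred_exists_isObstruction : REPred fun c => ∃ M, IsObstruction c M := by
  have hmem : PrimrecRel fun (m : Comparison) (L : List Comparison) => m ∈ L :=
    (PrimrecRel.comp (Primrec.eq.exists_mem_list) Primrec.snd Primrec.fst).of_eq fun x => by simp
  refine rePred_exists (PrimrecPred.and ?_ (PrimrecPred.and ?_ ?_))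
  · exact (Primrec.eq.comp Primrec.snd (Primrec.const [])).not
  · exact PrimrecRel.comp hmem.forall_mem_list Primrec.snd (primrec_comparisons.comp Primrec.fst)
  · exact primrecPred_balanced.comp Primrec.snd

end Computability

/-! ### Every coded data set has exactly one kind of certificate -/

/-- The difference of the two lotteries of a comparison. -/
noncomputable def difference (m : Comparison) : ℕ →₀ ℚ :=
  (Finsupp.single m.2.1.1 (m.1.1 : ℚ) + Finsupp.single m.2.1.2 (m.1.2 : ℚ)) -
    (Finsupp.single m.2.2.1 (m.1.1 : ℚ) + Finsupp.single m.2.2.2 (m.1.2 : ℚ))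

theorem difference_apply (m : Comparison) (k : ℕ) :
    difference m k = (mass m.1 m.2.1 k : ℚ) - mass m.1 m.2.2 k := by
  simp [difference, mass, Finsupp.single_apply]

theorem map_difference {W : Type*} [AddCommGroup W] [Module ℚ W] (f : (ℕ →₀ ℚ) →ₗ[ℚ] W)
    (m : Comparison) :
    f (difference m) =
      ((m.1.1 : ℚ) • f (Finsupp.single m.2.1.1 1) + (m.1.2 : ℚ) • f (Finsupp.single m.2.1.2 1)) -
      ((m.1.1 : ℚ) • f (Finsupp.single m.2.2.1 1) + (m.1.2 : ℚ) • f (Finsupp.single m.2.2.2 1)) := by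
  have h : ∀ (i : ℕ) (a : ℚ), Finsupp.single i a = a • Finsupp.single i (1 : ℚ) := fun i a => by
    simp
  rw [difference, h, h _ (m.1.2 : ℚ), h m.2.2.1, h m.2.2.2]
  simp only [map_sub, map_add, map_smul]

theorem mass_eq_zero_of_notMem {m : Comparison} {k : ℕ} (h : k ∉ indices m) :
    mass m.1 m.2.1 k = 0 ∧ mass m.1 m.2.2 k = 0 := by
  simp only [indices, List.mem_cons, List.not_mem_nil, or_false, not_or] at h
  obtain ⟨h1, h2, h3, h4⟩ := h
  simp [mass, Ne.symm h1, Ne.symm h2, Ne.symm h3, Ne.symm h4]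

/-- Outcomes that do not occur carry no mass, so the decidable check over occurring outcomes
suffices. -/
theorem Balanced.sum_eq {M : List Comparison} (h : Balanced M) (k : ℕ) :
    (M.map fun m => mass m.1 m.2.1 k).sum = (M.map fun m => mass m.1 m.2.2 k).sum := by
  by_cases hk : k ∈ M.flatMap indices
  · exact h k hk
  · congr 1
    refine List.map_congr_left fun m hm => ?_
    have := mass_eq_zero_of_notMem fun hi => hk (List.mem_flatMap.2 ⟨m, hm, hi⟩)
    rw [this.1, this.2]

theorem sum_difference_apply (M : List Comparison) (k : ℕ) :
    (M.map difference).sum k = (((M.map fun m => mass m.1 m.2.1 k).sum : ℕ) : ℚ) -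
      ((M.map fun m => mass m.1 m.2.2 k).sum : ℕ) := by
  induction M with
  | nil => simp
  | cons m M ih =>
    simp only [List.map_cons, List.sum_cons, Finsupp.add_apply, ih, difference_apply]
    push_cast; ring

theorem balanced_iff_sum_difference {M : List Comparison} :
    Balanced M ↔ (M.map difference).sum = 0 := by
  constructor
  · intro h
    ext k
    rw [sum_difference_apply, h.sum_eq, sub_self, Finsupp.zero_apply]
  · intro h k _
    have := sum_difference_apply M k
    rw [h, Finsupp.zero_apply, eq_comm, sub_eq_zero] at this
    exact_mod_cast this

theorem exists_lt_of_list (L : List ℕ) : ∃ N, ∀ k ∈ L, k < N :=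
  ⟨L.sum + 1, fun _ hk => Nat.lt_succ_of_le (List.single_le_sum (by simp) _ hk)⟩

/-- Finitely many rational values become natural numbers after a positive affine transformation. -/
theorem exists_list_of_rat (F : ℕ → ℚ) (N : ℕ) : ∃ (v : List ℕ) (d C : ℚ), 0 < d ∧
    ∀ i < N, (v.getD i 0 : ℚ) = d * F i + C := by
  obtain ⟨d, hd⟩ := IsLocalization.exist_integer_multiples (nonZeroDivisors ℤ) (Finset.range N) F
  choose! z hz using fun i (hi : i < N) => hd i (Finset.mem_range.2 hi)
  have hd0 : ((d : ℤ) : ℚ) ≠ 0 := by exact_mod_cast nonZeroDivisors.coe_ne_zero d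
  obtain ⟨C, hC⟩ : ∃ C : ℤ, ∀ i < N, 0 ≤ (d : ℤ) * z i + C := by
    refine ⟨∑ i ∈ Finset.range N, |(d : ℤ) * z i|, fun i hi => ?_⟩
    have h1 := Finset.single_le_sum (f := fun i => |(d : ℤ) * z i|) (fun _ _ => abs_nonneg _)
      (Finset.mem_range.2 hi)
    have h2 := neg_abs_le ((d : ℤ) * z i)
    linarith
  -- The common denominator `d` may be negative, hence the factor `d ^ 2`; `C` makes all values
  -- nonnegative.
  refine ⟨(List.range N).map fun i => ((d : ℤ) * z i + C).toNat, ((d : ℤ) : ℚ) ^ 2, C,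
    by positivity, fun i hi => ?_⟩
  have hzi : (z i : ℚ) = ((d : ℤ) : ℚ) * F i := by
    have := hz i hi
    rw [Algebra.smul_def] at this
    simpa using this
  rw [List.getD_eq_getElem _ _ (by simpa using hi)]
  simp only [List.getElem_map, List.getElem_range]
  rw [← Int.cast_natCast, Int.toNat_of_nonneg (hC i hi)]
  push_cast
  rw [hzi]; ring

/-- The real values `F` of the outcomes agree with a comparison. -/
def RealAgrees (F : ℕ → ℝ) (m : Comparison) : Prop :=
  m.1.1 * F m.2.2.1 + m.1.2 * F m.2.2.2 < m.1.1 * F m.2.1.1 + m.1.2 * F m.2.1.2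

/-- The ℚ-linear extension of `F` would be positive on each difference but zero on their sum.
Rational obstructions thus exclude real values too. -/
theorem IsObstruction.not_realAgrees {c : Code} {M : List Comparison} (h : IsObstruction c M)
    (F : ℕ → ℝ) : ¬ ∀ m ∈ comparisons c, RealAgrees F m := by
  intro hF
  obtain ⟨hne, hM, hbal⟩ := h
  let f : (ℕ →₀ ℚ) →ₗ[ℚ] ℝ := Finsupp.linearCombination ℚ F
  have hpos : ∀ m ∈ M, 0 < f (difference m) := fun m hm => by
    have := hF m (hM m hm)
    rw [map_difference, sub_pos]
    simpa [f, RealAgrees, Rat.smul_def] using this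
  have h0 := congrArg f (balanced_iff_sum_difference.1 hbal)
  rw [map_zero, map_list_sum, List.map_map] at h0
  exact (List.sum_pos _ (List.forall_mem_map.2 hpos) (by simpa using hne)).ne' h0

theorem feasible_or_exists_isObstruction (c : Code) :
    Feasible c ∨ ∃ M, IsObstruction c M := by
  rcases exists_pos_functional_or_posComb_zero (K := ℚ)
    ((comparisons c).map difference).toFinset.finite_toSet with ⟨g, hg⟩ | h
  · left
    obtain ⟨N, hN⟩ := exists_lt_of_list ((comparisons c).flatMap indices)
    obtain ⟨v, d, C, hd, hv⟩ := exists_list_of_rat (fun i => g (Finsupp.single i 1)) N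
    refine ⟨v, fun m hm => ?_⟩
    have hi : ∀ k ∈ indices m, (v.getD k 0 : ℚ) = d * g (Finsupp.single k 1) + C := fun k hk =>
      hv k (hN k (List.mem_flatMap.2 ⟨m, hm, hk⟩))
    have hpos : 0 < g (difference m) :=
      hg _ (Finset.mem_coe.2 (List.mem_toFinset.2 (List.mem_map_of_mem hm)))
    rw [map_difference] at hpos
    simp only [smul_eq_mul] at hpos
    have : (value v m.1 m.2.2 : ℚ) < value v m.1 m.2.1 := by
      simp only [value, Nat.cast_add, Nat.cast_mul]
      rw [hi _ (by simp [indices]), hi _ (by simp [indices]), hi _ (by simp [indices]),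
        hi _ (by simp [indices])]
      -- Both sides carry the same total weight, so `C` cancels.
      nlinarith [mul_pos hd hpos]
    exact_mod_cast this
  · right
    obtain ⟨d, M, hd, hne, hM, hsum⟩ := h.exists_list_sum
    choose! r hr using fun s (hs : s ∈ M) =>
      List.mem_map.1 (List.mem_toFinset.1 (Finset.mem_coe.1 (hM s hs)))
    refine ⟨M.map r, by simpa using hne, fun m hm => ?_, balanced_iff_sum_difference.2 ?_⟩
    · obtain ⟨s, hs, rfl⟩ := List.mem_map.1 hm
      exact (hr s hs).1
    · rw [List.map_map, List.map_congr_left (f := difference ∘ r) (g := id) fun s hs => (hr s hs).2,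
        List.map_id, ← hsum, smul_zero]

theorem feasible_iff_exists_realAgrees (c : Code) :
    Feasible c ↔ ∃ F : ℕ → ℝ, ∀ m ∈ comparisons c, RealAgrees F m := by
  constructor
  · rintro ⟨v, hv⟩
    refine ⟨fun i => (v.getD i 0 : ℕ), fun m hm => ?_⟩
    have := hv m hm
    unfold Agrees value at this
    simp only [RealAgrees]
    exact_mod_cast this
  · rintro ⟨F, hF⟩
    exact (feasible_or_exists_isObstruction c).resolve_right fun ⟨_, hM⟩ => hM.not_realAgrees F hF

/-- By Post's theorem, since feasibility and its negation are both recursively enumerable. -/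
theorem computablePred_feasible : ComputablePred Feasible := by
  refine ComputablePred.computable_iff_re_compl_re'.2 ⟨rePred_feasible,
    rePred_exists_isObstruction.of_eq fun c => ⟨?_, (feasible_or_exists_isObstruction c).resolve_left⟩⟩
  rintro ⟨M, hM⟩ h
  obtain ⟨F, hF⟩ := (feasible_iff_exists_realAgrees c).1 h
  exact hM.not_realAgrees F hF

/-! ### From coded comparisons back to lotteries -/

theorem mem_comparisons {c : Code} {m : Comparison} :
    m ∈ comparisons c ↔ (∃ o ∈ c.2.2, ∃ e ∈ o.2, ((c.1.1, c.1.2 - c.1.1), o.1, e) = m) ∧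
      ¬ Balanced [m] := by
  simp only [comparisons, List.mem_filter, List.mem_flatMap, List.mem_map, decide_eq_true_eq]

/-- The filter in `comparisons` thus drops exactly the pairs of equal lotteries. Injectivity of the
numbering makes masses of indices match masses of bundles. -/
theorem lottery_eq_iff_balanced {n : ℕ} {α : ℝ} {w : ℕ × ℕ} {b : ℝ} (hb : b ≠ 0)
    (hw₁ : (w.1 : ℝ) = b * α) (hw₂ : (w.2 : ℝ) = b * (1 - α)) {Y : Finset (Bundle n)} {N : ℕ}
    {y : ℕ → Bundle n} (hy : Set.BijOn y (Set.Iio N) (Y : Set (Bundle n))) {p q : ℕ × ℕ}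
    (hp₁ : p.1 < N) (hp₂ : p.2 < N) (hq₁ : q.1 < N) (hq₂ : q.2 < N) :
    lottery α (y p.1) (y p.2) = lottery α (y q.1) (y q.2) ↔ Balanced [(w, p, q)] := by
  classical
  have hmass : ∀ e : ℕ × ℕ, e.1 < N → e.2 < N → ∀ k < N,
      (mass w e k : ℝ) = b * lottery α (y e.1) (y e.2) (y k) := by
    intro e h1 h2 k hk
    have e1 : y e.1 = y k ↔ e.1 = k := hy.injOn.eq_iff h1 hk
    have e2 : y e.2 = y k ↔ e.2 = k := hy.injOn.eq_iff h2 hk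
    simp only [mass, lottery, Finsupp.add_apply, Finsupp.single_apply, e1, e2]
    push_cast
    rw [hw₁, hw₂]
    split_ifs <;> ring
  constructor
  · intro h k hk
    have hkN : k < N := by
      simp only [indices, List.flatMap_cons, List.flatMap_nil, List.append_nil, List.mem_cons,
        List.not_mem_nil, or_false] at hk
      rcases hk with rfl | rfl | rfl | rfl <;> assumption
    have h1 := hmass p hp₁ hp₂ k hkN
    rw [h, ← hmass q hq₁ hq₂ k hkN] at h1
    simpa using (by exact_mod_cast h1 : mass w p k = mass w q k)
  · intro h
    ext z
    by_cases hz : z ∈ Y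
    · obtain ⟨k, hk, rfl⟩ := hy.surjOn hz
      refine mul_left_cancel₀ hb ?_
      rw [← hmass p hp₁ hp₂ k hk, ← hmass q hq₁ hq₂ k hk]
      have := h.sum_eq k
      simp only [List.map_cons, List.map_nil, List.sum_singleton] at this
      rw [this]
    · have hsupp : ∀ e : ℕ × ℕ, e.1 < N → e.2 < N → lottery α (y e.1) (y e.2) z = 0 :=
        fun e h1 h2 => Finsupp.notMem_support_iff.1 fun hmem =>
          hz (lottery_support_subset (hy.mapsTo h1) (hy.mapsTo h2) hmem)
      rw [hsupp p hp₁ hp₂, hsupp q hq₁ hq₂]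

theorem Describes.feasible_iff {n : ℕ} {c : Code} {α : ℝ} (h1 : α ≤ 1)
    {Y : Finset (Bundle n)} {E : Set ((Bundle n →₀ ℝ) × Set (Bundle n →₀ ℝ))}
    (h : Describes c α Y E) : Feasible c ↔ ∃ f, StrictlyRepresents f E := by
  classical
  obtain ⟨hb, hα, y, hy, hL, rfl⟩ := h
  have hb0 : (0 : ℝ) < c.1.2 := by exact_mod_cast Nat.pos_of_ne_zero hb
  have hle : c.1.1 ≤ c.1.2 := by
    rw [hα, div_le_one hb0] at h1
    exact_mod_cast h1
  have hw₁ : (c.1.1 : ℝ) = c.1.2 * α := by rw [hα]; field_simp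
  -- The truncated subtraction is exact because `α ≤ 1`.
  have hw₂ : ((c.1.2 - c.1.1 : ℕ) : ℝ) = c.1.2 * (1 - α) := by
    rw [Nat.cast_sub hle, hw₁]; ring
  have hmap : ∀ (f : (Bundle n →₀ ℝ) →ₗ[ℝ] ℝ) (e : ℕ × ℕ),
      (c.1.2 : ℝ) * f (lottery α (y e.1) (y e.2)) = c.1.1 * f (Finsupp.single (y e.1) 1) +
        ((c.1.2 - c.1.1 : ℕ) : ℝ) * f (Finsupp.single (y e.2) 1) := fun f e => by
    rw [map_lottery, hw₁, hw₂]; ring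
  have hmem : ∀ o ∈ c.2.2, ∀ e ∈ o.2,
      (((c.1.1, c.1.2 - c.1.1), o.1, e) ∈ comparisons c ↔
        lottery α (y e.1) (y e.2) ≠ lottery α (y o.1.1) (y o.1.2)) := by
    intro o ho e he
    obtain ⟨⟨ho1, ho2⟩, he'⟩ := hL o ho
    rw [mem_comparisons, ← lottery_eq_iff_balanced (w := (c.1.1, c.1.2 - c.1.1)) hb0.ne' hw₁ hw₂ hy ho1 ho2 (he' e he).1
      (he' e he).2, ne_comm]
    exact and_iff_right ⟨o, ho, e, he, rfl⟩
  rw [feasible_iff_exists_realAgrees]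
  constructor
  · rintro ⟨F, hF⟩
    let G : Bundle n → ℝ := fun x => F (Function.invFunOn y (Set.Iio c.2.1) x)
    have hG : ∀ i < c.2.1, G (y i) = F i := fun i hi =>
      congrArg F (hy.injOn.leftInvOn_invFunOn hi)
    refine ⟨Finsupp.linearCombination ℝ G, ?_⟩
    rintro p q ⟨Q, ⟨o, ho, hpQ⟩, hq, hne⟩
    obtain ⟨rfl, rfl⟩ := Prod.mk.inj hpQ
    obtain ⟨e, he, rfl⟩ := hq
    obtain ⟨⟨ho1, ho2⟩, he'⟩ := hL o ho
    have := hF _ ((hmem o ho e he).2 hne)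
    refine lt_of_mul_lt_mul_left ?_ hb0.le
    rw [hmap, hmap]
    simp only [Finsupp.linearCombination_single, one_smul, hG _ ho1, hG _ ho2,
      hG _ (he' e he).1, hG _ (he' e he).2]
    exact this
  · rintro ⟨f, hf⟩
    refine ⟨fun i => f (Finsupp.single (y i) 1), fun m hm => ?_⟩
    obtain ⟨o, ho, e, he, rfl⟩ := (mem_comparisons.1 hm).1
    have := mul_lt_mul_of_pos_left (hf _ _ ⟨_, ⟨o, ho, rfl⟩, ⟨e, he, rfl⟩,
      (hmem o ho e he).1 hm⟩) hb0
    rwa [hmap, hmap] at this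

end Bracketing

theorem theorem1 :
    -- (i) broad bracketing
    (∀ (n : ℕ) (D : Bracketing.DataSet n) (s : Bracketing.Sense),
      (Bracketing.FreeDisposal D.BB → Bracketing.Undominated D.BB →
        (Bracketing.SARP D.BB ↔ D.RationalizableBB s)) ∧
      (Bracketing.MonotoneSARP D.BB ↔ D.RationalizableBB s)) ∧
    -- (ii) narrow bracketing
    (∀ (n : ℕ) (D : Bracketing.DataSet n) (s : Bracketing.Sense),
      (Bracketing.FreeDisposal D.NB → Bracketing.Undominated D.NB →
        (Bracketing.SARP D.NB ↔ D.RationalizableNB s)) ∧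
      (Bracketing.MonotoneSARP D.NB ↔ D.RationalizableNB s)) ∧
    -- (iii) partial-narrow bracketing: the linear axiom on the lottery data set, and an algorithm
    (∀ (n : ℕ) (D : Bracketing.DataSet n) (s : Bracketing.Sense) (α : ℝ), 0 ≤ α → α ≤ 1 →
      ∀ Y : Finset (Bracketing.Bundle n), D.Supports α Y →
        ((Bracketing.Undominated D.NB ∧ Bracketing.LARP Y (D.lotteryData α Y)) ↔
          D.RationalizablePNB s α)) ∧
    (∃ f : Bracketing.Code → Bool, Computable f ∧
      ∀ (n : ℕ) (D : Bracketing.DataSet n) (s : Bracketing.Sense) (α : ℚ), 0 ≤ α → α ≤ 1 →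
        Bracketing.Undominated D.NB →
        ∀ Y : Finset (Bracketing.Bundle n), D.Supports (α : ℝ) Y →
          ∀ c : Bracketing.Code,
            Bracketing.Describes c (α : ℝ) Y (D.lotteryData (α : ℝ) Y) →
            (f c = true ↔ D.RationalizablePNB s (α : ℝ))) := by
  refine ⟨fun n D s => ⟨fun hfd hud => ?_, D.monotoneSARP_BB_iff s⟩,
    fun n D s => ⟨fun hfd hud => ?_, D.monotoneSARP_NB_iff s⟩, fun n D s α h0 h1 Y hY => ?_, ?_⟩
  · rw [Bracketing.sarp_iff_monotoneSARP hfd hud, D.monotoneSARP_BB_iff s]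
  · rw [Bracketing.sarp_iff_monotoneSARP hfd hud, D.monotoneSARP_NB_iff s]
  · rw [D.rationalizablePNB_iff h0 h1 hY s, D.larp_iff h0 h1 hY]
  · obtain ⟨_, hf⟩ := Bracketing.computablePred_feasible
    refine ⟨fun c => decide (Bracketing.Feasible c), hf, fun n D s α h0 h1 hud Y hY c hc => ?_⟩
    have h0' : (0 : ℝ) ≤ α := by exact_mod_cast h0
    have h1' : (α : ℝ) ≤ 1 := by exact_mod_cast h1
    rw [decide_eq_true_iff, hc.feasible_iff h1', D.rationalizablePNB_iff h0' h1' hY s]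
    exact (and_iff_right hud).symm
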